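/- Let $R$ be a commutative noetherian local ring with maximal ideal $\mathfrak m$ and residue field $k=R/\mathfrak m$, let $t=\operatorname{depth} R$, and let $M$ be a finitely generated $R$-module of depth at least $t$ (the zero module has depth $\infty$). For a finitely generated $R$-module $N$ and a presentation $P_1\xrightarrow{\partial}P_0\to N\to 0$ by finitely generated projective modules, the syzygy and the Auslander transpose of $N$ are $\Omega N=\operatorname{Im}\partial$ and $\operatorname{Tr}N=\operatorname{Coker}(\partial^\ast\colon P_0^\ast\to P_1^\ast)$, where $(-)^\ast=\operatorname{Hom}_R(-,R)$; put $\Omega^0N=N$ and $\Omega^nN=\Omega(\Omega^{n-1}N)$ for $n>0$. Put $\beta_i(M)=\dim_k\operatorname{Tor}^R_i(k,M)$, $\mu_i(M)=\dim_k\operatorname{Ext}_R^i(k,M)$, and let $r(R)=\dim_k\operatorname{Ext}^t_R(k,R)$ be the type of $R$. Then, for every choice of presentations in the formation of $\operatorname{Tr}\Omega^t k$, the module $\operatorname{Ext}^i_R(\operatorname{Tr}\Omega^tk,M)$ is annihilated by $\mathfrak m$, i.e. is a $k$-vector space, and is finite-dimensional, for every integer $i>0$, and the following hold. 1. $\dim_k\operatorname{Ext}^i_R(\operatorname{Tr}\Omega^tk,M)=\beta_{t-i+1}(M)$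 for all $1\le i\le t$. 2. $\dim_k\operatorname{Ext}^{t+1}_R(\operatorname{Tr}\Omega^tk,M)-\dim_k\operatorname{Ext}^{t+2}_R(\operatorname{Tr}\Omega^tk,M)=\beta_0(M)-r(R)\mu_t(M)$. 3. $\dim_k\operatorname{Ext}^i_R(\operatorname{Tr}\Omega^tk,M)=r(R)\mu_{i-2}(M)$ for all $i\ge t+3$. -/

import Mathlib

open CategoryTheory Abelian IsLocalRing

universe u

namespace LocalExt

/-! ### Vector spaces over the residue field -/

section ResidueSpace

variable (R : Type u) [CommRing R] [IsLocalRing R]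

/-- The `R`-module `E` is a vector space over the residue field `k`:
the maximal ideal annihilates `E`, so that the `R`-action factors through `k`. -/
abbrev IsResidueSpace (E : Type u) [AddCommGroup E] [Module R E] : Prop :=
  Module.IsTorsionBySet R E (maximalIdeal R : Set R)

variable {R}

/-- The `k`-vector space structure on an `R`-module annihilated by the maximal ideal;
the class of `r : R` acts as `r`. -/
noncomputable abbrev IsResidueSpace.residueModule {E : Type u} [AddCommGroup E] [Module R E]
    (h : IsResidueSpace R E) : Module (ResidueField R) E :=
  Module.IsTorsionBySet.module (I := maximalIdeal R) h

/-- The dimension over `k` of an `R`-module annihilated by the maximal ideal. It is only used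
for finitely generated `R`-modules, for which it is finite. -/
noncomputable def IsResidueSpace.dim {E : Type u} [AddCommGroup E] [Module R E]
    (h : IsResidueSpace R E) : ℕ :=
  letI := h.residueModule
  Module.finrank (ResidueField R) E

theorem residueField_isResidueSpace : IsResidueSpace R (ResidueField R) := by
  rintro x ⟨r, hr⟩
  change r • x = 0
  rw [Algebra.smul_def]
  have h : algebraMap R (ResidueField R) r = 0 := (residue_eq_zero_iff r).2 hr
  rw [h, zero_mul]

theorem tensor_residueField_isResidueSpace (N : Type u) [AddCommGroup N] [Module R N] :
    IsResidueSpace R (TensorProduct R (ResidueField R) N) := by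
  rintro x ⟨r, hr⟩
  change r • x = 0
  induction x using TensorProduct.induction_on with
  | zero => exact smul_zero r
  | tmul a b =>
    rw [TensorProduct.smul_tmul',
      show r • a = 0 from residueField_isResidueSpace (R := R) (x := a) (a := ⟨r, hr⟩),
      TensorProduct.zero_tmul]
  | add x y hx hy => rw [smul_add, hx, hy, add_zero]

variable (R) in
/-- The residue field `k` as an `R`-module. -/
noncomputable abbrev resField : ModuleCat.{u} R := ModuleCat.of R (ResidueField R)

theorem ext_resField_isResidueSpace (M : ModuleCat.{u} R) (i : ℕ) :
    IsResidueSpace R (Ext (resField R) M i) := by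
  rintro e ⟨r, hr⟩
  change r • e = 0
  have h0 : r • 𝟙 (resField R) = 0 := by
    ext x
    exact residueField_isResidueSpace (R := R) (x := x) (a := ⟨r, hr⟩)
  have h1 : r • e = (Ext.mk₀ (r • 𝟙 (resField R))).comp e (zero_add i) := by
    simp [Ext.mk₀_smul]
  rw [h1, h0]
  simp

theorem tor_resField_isResidueSpace (M : ModuleCat.{u} R) (i : ℕ) :
    IsResidueSpace R (((Tor (ModuleCat.{u} R) i).obj (resField R)).obj M) := by
  rintro e ⟨r, hr⟩
  change r • e = 0
  let F := (MonoidalCategory.tensoringLeft (ModuleCat.{u} R)).obj (resField R)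
  let P := projectiveResolution M
  let K := (F.mapHomologicalComplex (ComplexShape.down ℕ)).obj P.complex
  have hX (j : ℕ) : r • 𝟙 (K.X j) = 0 := by
    ext x
    exact tensor_residueField_isResidueSpace (R := R) (P.complex.X j) (x := x) (a := ⟨r, hr⟩)
  have hS : r • 𝟙 (K.sc i) = 0 := by
    ext1
    · exact hX _
    · exact hX _
    · exact hX _
  have hH : r • 𝟙 (K.homology i) = 0 := by
    have := ShortComplex.homologyMap_smul (𝟙 (K.sc i)) r
    rw [hS, ShortComplex.homologyMap_zero, ShortComplex.homologyMap_id] at this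
    exact this.symm
  let φ : ((Tor (ModuleCat.{u} R) i).obj (resField R)).obj M ≅ K.homology i :=
    P.isoLeftDerivedObj F i
  apply φ.toLinearEquiv.injective
  rw [map_smul, map_zero]
  exact congrArg (fun f => f.hom (φ.toLinearEquiv e)) hH

/-- The Betti number `β_i(M) = dim_k Tor_i(k, M)`. -/
noncomputable def betti (i : ℕ) (M : ModuleCat.{u} R) : ℕ :=
  (tor_resField_isResidueSpace M i).dim

/-- The Bass number `μ_i(M) = dim_k Ext^i(k, M)`. -/
noncomputable def bass (i : ℕ) (M : ModuleCat.{u} R) : ℕ :=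
  (ext_resField_isResidueSpace M i).dim

end ResidueSpace

/-! ### Depth and type -/

section Depth

variable (R : Type u) [CommRing R] [IsLocalRing R]

/-- The depth of a module over a local ring: the supremum of the lengths of `M`-sequences in the
maximal ideal. For finitely generated `M ≠ 0` the condition `M ≠ (x₁, …, xₙ)M` is automatic by
Nakayama's lemma; the zero module gets depth `∞`, as usual. -/
noncomputable def depth (M : Type u) [AddCommGroup M] [Module R M] : ℕ∞ :=
  ⨆ (rs : List R) (_ : (∀ r ∈ rs, r ∈ maximalIdeal R) ∧
    RingTheory.Sequence.IsWeaklyRegular M rs), (rs.length : ℕ∞)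

/-- The type `r(R) = dim_k Ext^{depth R}(k, R)` of a noetherian local ring
(whose depth is finite). -/
noncomputable def ringType : ℕ :=
  bass (depth R R).toNat (ModuleCat.of R R)

end Depth

/-! ### Syzygies and transposes -/

section Syzygy

variable (R : Type u) [CommRing R]

/-- A presentation `P₁ --d--> P₀ --ε--> M → 0` of the `R`-module `M` by finitely generated
projective modules. -/
structure ProjPres (M : Type u) [AddCommGroup M] [Module R M] where
  P₁ : ModuleCat.{u} R
  P₀ : ModuleCat.{u} R
  finite₁ : Module.Finite R P₁
  finite₀ : Module.Finite R P₀
  projective₁ : Module.Projective R P₁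
  projective₀ : Module.Projective R P₀
  d : P₁ →ₗ[R] P₀
  ε : P₀ →ₗ[R] M
  exact : Function.Exact d ε
  surjective : Function.Surjective ε

variable {R}

/-- The first syzygy `Ω M = Im d` given by a presentation. -/
abbrev ProjPres.syzygy {M : Type u} [AddCommGroup M] [Module R M] (P : ProjPres R M) : Type u :=
  LinearMap.range P.d

/-- The Auslander transpose `Tr M = Coker (d^* : P₀^* → P₁^*)` given by a presentation. -/
abbrev ProjPres.transpose {M : Type u} [AddCommGroup M] [Module R M] (P : ProjPres R M) :
    Type u :=
  Module.Dual R P.P₁ ⧸ LinearMap.range P.d.dualMap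

/-- `N` is an `n`-th syzygy `Ω^n M` of `M`, for some choice of presentations. -/
def IsSyzygy : ℕ → ModuleCat.{u} R → ModuleCat.{u} R → Prop
  | 0, M, N => Nonempty (N ≃ₗ[R] M)
  | n + 1, M, N => ∃ L : ModuleCat.{u} R, IsSyzygy n M L ∧
      ∃ P : ProjPres R L, Nonempty (N ≃ₗ[R] P.syzygy)

/-- `T` is an Auslander transpose `Tr N` of `N`, for some choice of a presentation. -/
def IsTranspose (N T : ModuleCat.{u} R) : Prop :=
  ∃ P : ProjPres R N, Nonempty (T ≃ₗ[R] P.transpose)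

end Syzygy

end LocalExt

/-!
Let `K` be a module with `Extⁱ(K, R) = 0` for `i < n`, let `T = Tr Ωⁿ K` and `X = Extⁿ(K, R)`.
There is a long exact sequence
`0 → Ext¹(T, M) → Torₙ(K, M) → Hom(X, M) → Ext²(T, M) → Torₙ₋₁(K, M) → Ext¹(X, M) → ⋯`
in which the `Tor` terms run out after `Tor₀`. It is found by induction on `n`. For a short exact
sequence `0 → S → Q → L → 0` with `S = Ωⁿ⁺¹ K`, `L = Ωⁿ K`, and a presentation `P₁ → P₀ → S → 0`,
dualizing gives the exact sequence `0 → X → Tr L → P₁^* → Tr S → 0` with `X = Ext¹(L, R)`, which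
yields a long exact sequence of the `Ext(-, M)`; its lowest middle term
`Coker (Hom(P₁^*, M) → Hom(Tr L, M))` is `Ker (S ⊗ M → Q ⊗ M) = Tor₁(L, M)`, and the induction
hypothesis, where `Extⁿ(K, R) = 0`, identifies the others with `Tor` modules.

For `K = k` and `n = t`, the module `X` is `k` to the power of the `t`-th Bass number of `R`, so
that `Extⁱ(X, M)` vanishes for `i < t`: the `Tor` terms and the `Ext(X, M)` terms overlap in the
single degree `t`, where the sequence gives the alternating sum of dimensions.
-/

namespace LocalExt

section ResidueSpace

variable {R : Type u} [CommRing R] [IsLocalRing R]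
variable {E F : Type u} [AddCommGroup E] [Module R E] [AddCommGroup F] [Module R F]

theorem IsResidueSpace.of_injective (h : IsResidueSpace R F) (f : E →ₗ[R] F)
    (hf : Function.Injective f) : IsResidueSpace R E := fun x r =>
  hf <| (f.map_smul (r : R) x).trans <| (h (x := f x) (a := r)).trans (map_zero f).symm

theorem IsResidueSpace.of_surjective (h : IsResidueSpace R E) (f : E →ₗ[R] F)
    (hf : Function.Surjective f) : IsResidueSpace R F := fun x r => by
  obtain ⟨y, rfl⟩ := hf x
  exact (f.map_smul (r : R) y).symm.trans ((congrArg f (h (x := y) (a := r))).trans (map_zero f))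

theorem IsResidueSpace.of_subsingleton [Subsingleton E] : IsResidueSpace R E :=
  fun _ _ => Subsingleton.elim _ _

theorem IsResidueSpace.pi (h : IsResidueSpace R E) (ι : Type) :
    IsResidueSpace R (ι → E) := fun x r =>
  funext fun i => h (x := x i) (a := r)

theorem IsResidueSpace.dim_congr (hE : IsResidueSpace R E) (hF : IsResidueSpace R F)
    (e : E ≃ₗ[R] F) : hE.dim = hF.dim := by
  let := hE.residueModule
  let := hF.residueModule
  have map_smul_residue (c : ResidueField R) (x : E) : e (c • x) = c • e x := by
    obtain ⟨r, rfl⟩ := Ideal.Quotient.mk_surjective c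
    exact e.map_smul r x
  exact LinearEquiv.finrank_eq { e with map_smul' := map_smul_residue }

theorem IsResidueSpace.finite_residueField (h : IsResidueSpace R E) [Module.Finite R E] :
    letI := h.residueModule
    Module.Finite (ResidueField R) E := by
  let := h.residueModule
  have : IsScalarTower R (ResidueField R) E := Module.IsTorsionBySet.isScalarTower h
  exact Module.Finite.of_restrictScalars_finite R (ResidueField R) E

theorem IsResidueSpace.length_eq_dim (h : IsResidueSpace R E) [Module.Finite R E] :
    Module.length R E = h.dim := by
  let := h.residueModule
  have : IsScalarTower R (ResidueField R) E := Module.IsTorsionBySet.isScalarTower h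
  have := h.finite_residueField
  rw [Module.length_eq_of_surjective (S := R) (R := ResidueField R) (M := E)
    Ideal.Quotient.mk_surjective, Module.length_eq_finrank]
  rfl

theorem IsResidueSpace.nonempty_equiv_pi (h : IsResidueSpace R E) [Module.Finite R E] :
    Nonempty (E ≃ₗ[R] (Fin h.dim → ResidueField R)) := by
  let := h.residueModule
  have : IsScalarTower R (ResidueField R) E := Module.IsTorsionBySet.isScalarTower h
  have := h.finite_residueField
  exact ⟨((Module.finBasis (ResidueField R) E).equivFun).restrictScalars R⟩

theorem IsResidueSpace.dim_pi [Module.Finite R E] (h : IsResidueSpace R E) (r : ℕ) :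
    (h.pi (Fin r)).dim = r * h.dim := by
  have hlength := Module.length_pi_of_fintype (R := R) (fun _ : Fin r => E)
  simp only [(h.pi (Fin r)).length_eq_dim, h.length_eq_dim, Finset.sum_const, Finset.card_univ,
    Fintype.card_fin, nsmul_eq_mul] at hlength
  exact_mod_cast hlength

theorem dim_sub_dim_of_exact [IsNoetherianRing R] {A B C D : Type u}
    [AddCommGroup A] [Module R A] [AddCommGroup B] [Module R B]
    [AddCommGroup C] [Module R C] [AddCommGroup D] [Module R D]
    [Module.Finite R B] [Module.Finite R C]
    (hA : IsResidueSpace R A) (hB : IsResidueSpace R B) (hC : IsResidueSpace R C)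
    (hD : IsResidueSpace R D) {f : A →ₗ[R] B} {g : B →ₗ[R] C} {p : C →ₗ[R] D}
    (hf : Function.Injective f) (hfg : Function.Exact f g) (hgp : Function.Exact g p)
    (hp : Function.Surjective p) : (hA.dim : ℤ) - hD.dim = (hB.dim : ℤ) - hC.dim := by
  have : Module.Finite R A := Module.Finite.of_injective f hf
  have : Module.Finite R D := Module.Finite.of_surjective p hp
  have hG : IsResidueSpace R (LinearMap.range g) :=
    hC.of_injective _ (Submodule.subtype_injective _)
  have hAB := Module.length_eq_add_of_exact f g.rangeRestrict hf g.surjective_rangeRestrict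
    (LinearMap.exact_iff.2 (g.ker_rangeRestrict.trans hfg.linearMap_ker_eq))
  have hCD := Module.length_eq_add_of_exact (LinearMap.range g).subtype p
    (Submodule.subtype_injective _) hp
    (LinearMap.exact_iff.2 (hgp.linearMap_ker_eq.trans (Submodule.range_subtype _).symm))
  rw [hA.length_eq_dim, hB.length_eq_dim, hG.length_eq_dim] at hAB
  rw [hC.length_eq_dim, hD.length_eq_dim, hG.length_eq_dim] at hCD
  norm_cast at hAB hCD
  omega

end ResidueSpace

section Depth

variable {R : Type u} [CommRing R] [IsLocalRing R]

theorem support_resField_subset :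
    Module.support R (resField R) ⊆ PrimeSpectrum.zeroLocus (maximalIdeal R) := by
  rw [Module.support_eq_zeroLocus]
  refine PrimeSpectrum.zeroLocus_anti_mono fun r hr => Module.mem_annihilator.2 fun x => ?_
  exact residueField_isResidueSpace (x := x) (a := ⟨r, hr⟩)

theorem subsingleton_ext_resField_of_lt_depth [IsNoetherianRing R] {M : ModuleCat.{u} R}
    [Module.Finite R M] {i : ℕ} (h : (i : ℕ∞) < depth R M) :
    Subsingleton (Ext (resField R) M i) := by
  simp only [depth, lt_iSup_iff] at h
  obtain ⟨rs, ⟨mem_rs, regular_rs⟩, hi⟩ := h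
  cases subsingleton_or_nontrivial M with
  | inl _ =>
    have hM : 𝟙 M = 0 := (ModuleCat.isZero_of_subsingleton M).eq_of_src _ _
    refine subsingleton_of_forall_eq 0 fun x => ?_
    rw [← x.comp_mk₀_id, hM, Ext.mk₀_zero, Ext.comp_zero]
  | inr _ =>
    refine ModuleCat.subsingleton_ext_of_exists_isRegular (maximalIdeal R) (resField R)
      support_resField_subset M ?_ rs mem_rs
      ((isRegular_iff_isWeaklyRegular_of_subset_maximalIdeal mem_rs).2 regular_rs) i
      (by exact_mod_cast hi)
    exact (Submodule.top_ne_ideal_smul_of_le_jacobson_annihilator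
      (maximalIdeal_le_jacobson _)).symm.lt_top

end Depth

/-! ### Long exact sequences -/

/-- An exact sequence `0 → A 0 → B 0 → C 0 → A 1 → B 1 → C 1 → A 2 → ⋯` of modules. -/
structure LongExactSequence (R : Type*) [CommRing R] (A B C : ℕ → Type*)
    [∀ n, AddCommGroup (A n)] [∀ n, Module R (A n)] [∀ n, AddCommGroup (B n)]
    [∀ n, Module R (B n)] [∀ n, AddCommGroup (C n)] [∀ n, Module R (C n)] where
  a (n : ℕ) : A n →ₗ[R] B n
  b (n : ℕ) : B n →ₗ[R] C n
  c (n : ℕ) : C n →ₗ[R] A (n + 1)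
  injective_a_zero : Function.Injective (a 0)
  exact_a_b (n : ℕ) : Function.Exact (a n) (b n)
  exact_b_c (n : ℕ) : Function.Exact (b n) (c n)
  exact_c_a (n : ℕ) : Function.Exact (c n) (a (n + 1))

namespace LongExactSequence

variable {R : Type*} [CommRing R] {A B C : ℕ → Type*}
  [∀ n, AddCommGroup (A n)] [∀ n, Module R (A n)] [∀ n, AddCommGroup (B n)]
  [∀ n, Module R (B n)] [∀ n, AddCommGroup (C n)] [∀ n, Module R (C n)]
  (s : LongExactSequence R A B C)

include s

theorem injective_a {n : ℕ} (hC : ∀ m < n, Subsingleton (C m)) : Function.Injective (s.a n) := by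
  cases n with
  | zero => exact s.injective_a_zero
  | succ n =>
    have := hC n n.lt_succ_self
    exact (LinearMap.injective_iff_eq_zero_of_exact (s.exact_c_a n)).2 (Subsingleton.elim _ _)

theorem surjective_a (n : ℕ) [Subsingleton (C n)] : Function.Surjective (s.a n) :=
  (LinearMap.surjective_iff_eq_zero_of_exact (s.exact_a_b n)).2 (Subsingleton.elim _ _)

theorem bijective_a {n : ℕ} (hC : ∀ m ≤ n, Subsingleton (C m)) : Function.Bijective (s.a n) :=
  have := hC n le_rfl
  ⟨s.injective_a fun m hm => hC m hm.le, s.surjective_a n⟩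

theorem surjective_c (n : ℕ) [Subsingleton (B (n + 1))] : Function.Surjective (s.c n) :=
  (LinearMap.surjective_iff_eq_zero_of_exact (s.exact_c_a n)).2 (Subsingleton.elim _ _)

theorem bijective_c (n : ℕ) [Subsingleton (B n)] [Subsingleton (B (n + 1))] :
    Function.Bijective (s.c n) :=
  ⟨(LinearMap.injective_iff_eq_zero_of_exact (s.exact_b_c n)).2 (Subsingleton.elim _ _),
    s.surjective_c n⟩

omit s

/-- Transport of a long exact sequence along linear equivalences. -/
def congr {A' B' C' : ℕ → Type*}
    [∀ n, AddCommGroup (A' n)] [∀ n, Module R (A' n)] [∀ n, AddCommGroup (B' n)]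
    [∀ n, Module R (B' n)] [∀ n, AddCommGroup (C' n)] [∀ n, Module R (C' n)]
    (eA : ∀ n, A n ≃ₗ[R] A' n) (eB : ∀ n, B n ≃ₗ[R] B' n) (eC : ∀ n, C n ≃ₗ[R] C' n) :
    LongExactSequence R A' B' C' where
  a n := eB n ∘ₗ s.a n ∘ₗ (eA n).symm
  b n := eC n ∘ₗ s.b n ∘ₗ (eB n).symm
  c n := eA (n + 1) ∘ₗ s.c n ∘ₗ (eC n).symm
  injective_a_zero :=
    (eB 0).injective.comp (s.injective_a_zero.comp (eA 0).symm.injective)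
  exact_a_b n := .of_ladder_linearEquiv_of_exact (e₁ := eA n) (e₂ := eB n) (e₃ := eC n)
    (by ext; simp) (by ext; simp) (s.exact_a_b n)
  exact_b_c n := .of_ladder_linearEquiv_of_exact (e₁ := eB n) (e₂ := eC n) (e₃ := eA (n + 1))
    (by ext; simp) (by ext; simp) (s.exact_b_c n)
  exact_c_a n := .of_ladder_linearEquiv_of_exact (e₁ := eC n) (e₂ := eA (n + 1))
    (e₃ := eB (n + 1)) (by ext; simp) (by ext; simp) (s.exact_c_a n)

/-- Dividing the first two columns of a long exact sequence by the images of maps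
`φ n : F n → A n`; this is harmless in positive degrees because `F` vanishes there. -/
def quotient {F : ℕ → Type*} [∀ n, AddCommGroup (F n)] [∀ n, Module R (F n)]
    (φ : ∀ n, F n →ₗ[R] A n) (hF : ∀ n, Subsingleton (F (n + 1))) :
    LongExactSequence R (fun n => A n ⧸ LinearMap.range (φ n))
      (fun n => B n ⧸ LinearMap.range (s.a n ∘ₗ φ n)) C where
  a n := Submodule.mapQ _ _ (s.a n) <| by
    rintro _ ⟨x, rfl⟩
    exact ⟨x, rfl⟩
  b n := Submodule.liftQ _ (s.b n) <| by
    rintro _ ⟨x, rfl⟩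
    exact (s.exact_a_b n).apply_apply_eq_zero _
  c n := Submodule.mkQ _ ∘ₗ s.c n
  injective_a_zero := by
    refine (injective_iff_map_eq_zero _).2 fun x hx => ?_
    obtain ⟨y, rfl⟩ := Submodule.mkQ_surjective _ x
    obtain ⟨z, hz⟩ := (Submodule.Quotient.mk_eq_zero _).1 hx
    exact (Submodule.Quotient.mk_eq_zero _).2 ⟨z, s.injective_a_zero hz⟩
  exact_a_b n x := by
    obtain ⟨y, rfl⟩ := Submodule.mkQ_surjective _ x
    refine (s.exact_a_b n y).trans ⟨?_, ?_⟩
    · rintro ⟨z, rfl⟩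
      exact ⟨Submodule.Quotient.mk z, rfl⟩
    · rintro ⟨z, hz⟩
      obtain ⟨z, rfl⟩ := Submodule.mkQ_surjective _ z
      obtain ⟨w, hw⟩ := (Submodule.Quotient.eq _).1 hz
      exact ⟨z - φ n w, by rw [map_sub, ← LinearMap.comp_apply, hw, sub_sub_cancel]⟩
  exact_b_c n x := by
    have hφ : LinearMap.range (φ (n + 1)) = ⊥ := by
      rw [Subsingleton.elim (φ (n + 1)) 0, LinearMap.range_zero]
    rw [LinearMap.comp_apply, Submodule.mkQ_apply, Submodule.Quotient.mk_eq_zero, hφ,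
      Submodule.mem_bot, s.exact_b_c n x]
    exact ((Submodule.mkQ_surjective _).exists (p := fun y => Submodule.liftQ _ _ _ y = x)).symm
  exact_c_a n x := by
    obtain ⟨y, rfl⟩ := Submodule.mkQ_surjective _ x
    constructor
    · intro hy
      obtain ⟨z, hz⟩ := (Submodule.Quotient.mk_eq_zero _).1 hy
      obtain ⟨w, hw⟩ := (s.exact_c_a n (y - φ (n + 1) z)).1 (by simp [← hz])
      refine ⟨w, (Submodule.Quotient.eq _).2 ⟨-z, ?_⟩⟩
      rw [hw, map_neg, sub_sub_cancel_left]
    · rintro ⟨z, hz⟩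
      rw [← hz]
      exact congrArg Submodule.Quotient.mk ((s.exact_c_a n).apply_apply_eq_zero z)

end LongExactSequence

namespace LongExactSequence

variable {R : Type u} [CommRing R] [IsLocalRing R] {A B C : ℕ → Type u}
  [∀ n, AddCommGroup (A n)] [∀ n, Module R (A n)] [∀ n, AddCommGroup (B n)]
  [∀ n, Module R (B n)] [∀ n, AddCommGroup (C n)] [∀ n, Module R (C n)]
  (s : LongExactSequence R A B C) {t : ℕ}

include s

theorem isResidueSpace (hB : ∀ n > t, Subsingleton (B n)) (hC : ∀ n < t, Subsingleton (C n))
    (resB : ∀ n, IsResidueSpace R (B n)) (resC : ∀ n, IsResidueSpace R (C n)) (n : ℕ) :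
    IsResidueSpace R (A n) := by
  rcases le_or_gt n t with hn | hn
  · exact (resB n).of_injective (s.a n) (s.injective_a fun m hm => hC m (hm.trans_le hn))
  · obtain ⟨m, rfl⟩ := Nat.exists_eq_add_one.2 (Nat.zero_lt_of_lt hn)
    have := hB (m + 1) hn
    exact (resC m).of_surjective (s.c m) (s.surjective_c m)

theorem dim_eq_of_lt (hC : ∀ n < t, Subsingleton (C n)) (resA : ∀ n, IsResidueSpace R (A n))
    (resB : ∀ n, IsResidueSpace R (B n)) {n : ℕ} (hn : n < t) : (resA n).dim = (resB n).dim :=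
  (resA n).dim_congr (resB n)
    (.ofBijective (s.a n) (s.bijective_a fun m hm => hC m (hm.trans_lt hn)))

theorem dim_sub_dim [IsNoetherianRing R] [Module.Finite R (B t)] [Module.Finite R (C t)]
    (hB : ∀ n > t, Subsingleton (B n)) (hC : ∀ n < t, Subsingleton (C n))
    (resA : ∀ n, IsResidueSpace R (A n)) (resB : ∀ n, IsResidueSpace R (B n))
    (resC : ∀ n, IsResidueSpace R (C n)) :
    ((resA t).dim : ℤ) - (resA (t + 1)).dim = (resB t).dim - (resC t).dim :=
  have := hB (t + 1) t.lt_succ_self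
  dim_sub_dim_of_exact _ _ _ _ (s.injective_a hC) (s.exact_a_b t) (s.exact_b_c t)
    (s.surjective_c t)

theorem dim_eq_of_gt (hB : ∀ n > t, Subsingleton (B n)) (resA : ∀ n, IsResidueSpace R (A n))
    (resC : ∀ n, IsResidueSpace R (C n)) {n : ℕ} (hn : t < n) :
    (resA (n + 1)).dim = (resC n).dim :=
  have := hB n hn
  have := hB (n + 1) (hn.trans n.lt_succ_self)
  ((resC n).dim_congr (resA (n + 1)) (.ofBijective (s.c n) (s.bijective_c n))).symm

end LongExactSequence

/-! ### Dimension shifting for `Ext` and `Tor` -/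

section Ext

variable {R : Type u} [CommRing R]

/-- `Ext⁰(A, M) = Hom(A, M)`. -/
noncomputable def extZeroEquiv (A M : ModuleCat.{u} R) : Ext A M 0 ≃ₗ[R] (A →ₗ[R] M) :=
  Ext.linearEquiv₀ ≪≫ₗ ModuleCat.homLinearEquiv

theorem extZeroEquiv_mk₀ {A M : ModuleCat.{u} R} (f : A ⟶ M) :
    extZeroEquiv A M (Ext.mk₀ f) = f.hom :=
  congrArg ModuleCat.Hom.hom ((Ext.linearEquiv₀ (R := R)).apply_symm_apply f)

theorem extZeroEquiv_comp_precomp {A B : ModuleCat.{u} R} (M : ModuleCat.{u} R) (f : A ⟶ B) :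
    extZeroEquiv A M ∘ₗ (Ext.mk₀ f).precompOfLinear R M (zero_add 0) =
      LinearMap.lcomp R M f.hom ∘ₗ extZeroEquiv B M := by
  ext x : 1
  obtain ⟨g, rfl⟩ := (Ext.mk₀_bijective _ _).2 x
  change extZeroEquiv A M ((Ext.mk₀ f).comp (Ext.mk₀ g) (zero_add 0)) =
    extZeroEquiv B M (Ext.mk₀ g) ∘ₗ f.hom
  rw [Ext.mk₀_comp_mk₀, extZeroEquiv_mk₀, extZeroEquiv_mk₀, ModuleCat.hom_comp]

/-- Invariance of `Ext` under isomorphism in the first variable. -/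
noncomputable def extCongrLeft {A B : ModuleCat.{u} R} (e : A ≃ₗ[R] B) (M : ModuleCat.{u} R)
    (n : ℕ) : Ext A M n ≃ₗ[R] Ext B M n :=
  LinearEquiv.ofLinearMap
    ((Ext.mk₀ e.toModuleIso.inv).precompOfLinear R M (zero_add n))
    ((Ext.mk₀ e.toModuleIso.hom).precompOfLinear R M (zero_add n))
    (by ext x; simp [-LinearEquiv.toModuleIso_inv, -LinearEquiv.toModuleIso_hom])
    (by ext x; simp [-LinearEquiv.toModuleIso_inv, -LinearEquiv.toModuleIso_hom])

theorem subsingleton_ext_of_subsingleton_left {A : ModuleCat.{u} R} [Subsingleton A]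
    (M : ModuleCat.{u} R) (n : ℕ) : Subsingleton (Ext A M n) := by
  have hA : 𝟙 A = 0 := (ModuleCat.isZero_of_subsingleton A).eq_of_src _ _
  refine subsingleton_of_forall_eq 0 fun x => ?_
  rw [← x.mk₀_id_comp, hA, Ext.mk₀_zero, Ext.zero_comp]

open Limits in
/-- `Ext^n(A^ι, M) = Ext^n(A, M)^ι` for finite `ι`. -/
noncomputable def extPiEquiv (ι : Type) [Fintype ι] (A M : ModuleCat.{u} R) (n : ℕ) :
    Ext (ModuleCat.of R (ι → A)) M n ≃ₗ[R] (ι → Ext A M n) :=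
  extCongrLeft (ModuleCat.biproductIsoPi fun _ : ι => A).symm.toLinearEquiv M n ≪≫ₗ
    { Ext.biproductAddEquiv (biproduct.isBilimit fun _ : ι => A) M n with
      map_smul' := fun r x => funext fun _ => Ext.comp_smul (Ext.mk₀ _) x (zero_add n) r }

/-- The cokernel of `Ext^n(g, M) : Ext^n(F, M) → Ext^n(U, M)`. -/
abbrev extCoker {U F : ModuleCat.{u} R} (g : U ⟶ F) (M : ModuleCat.{u} R) (n : ℕ) : Type u :=
  Ext U M n ⧸ LinearMap.range ((Ext.mk₀ g).precompOfLinear R M (zero_add n))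

/-- In degree zero `extCoker f M` is the cokernel of `Hom(f, M)`. -/
noncomputable def extCokerZeroEquiv {A B : ModuleCat.{u} R} (f : A ⟶ B) (M : ModuleCat.{u} R) :
    extCoker f M 0 ≃ₗ[R] (A →ₗ[R] M) ⧸ LinearMap.range (LinearMap.lcomp R M f.hom) :=
  Submodule.Quotient.equiv _ _ (extZeroEquiv A M) <|
    (LinearMap.range_comp _ _).symm.trans <|
      (congrArg LinearMap.range (extZeroEquiv_comp_precomp M f)).trans <|
        LinearEquiv.range_comp _ _

/-- In positive degrees `Ext^n(F, M)` vanishes for projective `F`, so nothing is divided out. -/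
noncomputable def extCokerSuccEquiv {U F : ModuleCat.{u} R} [Projective F] (g : U ⟶ F)
    (M : ModuleCat.{u} R) (n : ℕ) : extCoker g M (n + 1) ≃ₗ[R] Ext U M (n + 1) :=
  Submodule.quotEquivOfEqBot _ <| by
    have := Ext.subsingleton_of_projective F M n
    rw [Subsingleton.elim ((Ext.mk₀ g).precompOfLinear R M (zero_add (n + 1))) 0,
      LinearMap.range_zero]

variable {S : ShortComplex (ModuleCat.{u} R)} (hS : S.ShortExact) (M : ModuleCat.{u} R)

/-- The long exact sequence of `Ext(-, M)` attached to a short exact sequence. -/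
noncomputable def extLongExactSequence :
    LongExactSequence R (Ext S.X₃ M ·) (Ext S.X₂ M ·) (Ext S.X₁ M ·) where
  a n := (Ext.mk₀ S.g).precompOfLinear R M (zero_add n)
  b n := (Ext.mk₀ S.f).precompOfLinear R M (zero_add n)
  c n := hS.extClass.precompOfLinear R M (add_comm 1 n)
  injective_a_zero := by
    have : Epi S.g := hS.epi_g
    exact Ext.precomp_mk₀_injective_of_epi M S.g
  exact_a_b n :=
    (ShortComplex.ab_exact_iff_function_exact _).1 (Ext.contravariant_sequence_exact₂' hS M n)
  exact_b_c n := (ShortComplex.ab_exact_iff_function_exact _).1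
    (Ext.contravariant_sequence_exact₁' hS M n (n + 1) (add_comm 1 n))
  exact_c_a n := (ShortComplex.ab_exact_iff_function_exact _).1
    (Ext.contravariant_sequence_exact₃' hS M n (n + 1) (add_comm 1 n))

theorem shortExact_moduleCatMk {A B C : Type u} [AddCommGroup A] [Module R A] [AddCommGroup B]
    [Module R B] [AddCommGroup C] [Module R C] {f : A →ₗ[R] B} {g : B →ₗ[R] C}
    (hf : Function.Injective f) (hfg : Function.Exact f g) (hg : Function.Surjective g) :
    (ShortComplex.moduleCatMk f g hfg.linearMap_comp_eq_zero).ShortExact :=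
  ModuleCat.shortComplex_shortExact _ hfg hf hg

/-- Dimension shifting for `Ext` in the first variable. -/
noncomputable def extCokerEquivExtSucc {A B C : Type u} [AddCommGroup A] [Module R A]
    [AddCommGroup B] [Module R B] [AddCommGroup C] [Module R C] [Module.Projective R B]
    {f : A →ₗ[R] B} {g : B →ₗ[R] C}
    (hf : Function.Injective f) (hfg : Function.Exact f g) (hg : Function.Surjective g) (n : ℕ) :
    extCoker (ModuleCat.ofHom f) M n ≃ₗ[R] Ext (ModuleCat.of R C) M (n + 1) :=
  have hS := shortExact_moduleCatMk hf hfg hg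
  have : Projective (ShortComplex.moduleCatMk f g hfg.linearMap_comp_eq_zero).X₂ :=
    (IsProjective.iff_projective B).1 inferInstance
  ((extLongExactSequence hS M).exact_b_c n).linearEquivOfSurjective
    (precomp_extClass_surjective_of_projective_X₂ M hS n)

theorem nonempty_longExactSequence_extCoker {X U F T : Type u}
    [AddCommGroup X] [Module R X] [AddCommGroup U] [Module R U]
    [AddCommGroup F] [Module R F] [AddCommGroup T] [Module R T] [Module.Projective R F]
    {f : X →ₗ[R] U} {g : U →ₗ[R] F} {p : F →ₗ[R] T} (hf : Function.Injective f)
    (hfg : Function.Exact f g) (hgp : Function.Exact g p) (hp : Function.Surjective p) :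
    Nonempty (LongExactSequence R (fun n => Ext (ModuleCat.of R T) M (n + 1))
      (extCoker (ModuleCat.ofHom g) M) (Ext (ModuleCat.of R X) M ·)) := by
  have hXU : (ShortComplex.moduleCatMk f g.rangeRestrict _).ShortExact :=
    shortExact_moduleCatMk hf
      (LinearMap.exact_iff.2 (g.ker_rangeRestrict.trans hfg.linearMap_ker_eq))
      g.surjective_rangeRestrict
  have exact_range : Function.Exact (LinearMap.range g).subtype p :=
    LinearMap.exact_iff.2 (hgp.linearMap_ker_eq.trans (Submodule.range_subtype _).symm)
  have hF : Projective (ModuleCat.of R F) := (IsProjective.iff_projective F).1 inferInstance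
  let s := (extLongExactSequence hXU M).quotient
    (fun n => (Ext.mk₀ (ModuleCat.ofHom (LinearMap.range g).subtype)).precompOfLinear R M
      (zero_add n)) (fun n => Ext.subsingleton_of_projective (ModuleCat.of R F) M n)
  refine ⟨s.congr (extCokerEquivExtSucc M (Submodule.subtype_injective _) exact_range hp)
    (fun n => Submodule.quotEquivOfEq _ _ (congrArg LinearMap.range ?_))
    fun n => LinearEquiv.refl R _⟩
  ext x
  exact Ext.mk₀_comp_mk₀_assoc _ _ x

end Ext

section Tor

open MonoidalCategory

variable {R : Type u} [CommRing R]

/-- The complex `A ⊗ Q`. -/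
noncomputable abbrev tensorComplex (A : ModuleCat.{u} R) (Q : ChainComplex (ModuleCat.{u} R) ℕ) :
    ChainComplex (ModuleCat.{u} R) ℕ :=
  (((tensoringLeft (ModuleCat.{u} R)).obj A).mapHomologicalComplex (ComplexShape.down ℕ)).obj Q

/-- The chain map `f ⊗ Q : A ⊗ Q ⟶ B ⊗ Q`. -/
noncomputable abbrev tensorComplexMap {A B : ModuleCat.{u} R} (f : A ⟶ B)
    (Q : ChainComplex (ModuleCat.{u} R) ℕ) : tensorComplex A Q ⟶ tensorComplex B Q :=
  (NatTrans.mapHomologicalComplex ((tensoringLeft (ModuleCat.{u} R)).map f)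
    (ComplexShape.down ℕ)).app Q

/-- The short complex of chain complexes `S ⊗ Q`. -/
noncomputable abbrev tensorShortComplex (S : ShortComplex (ModuleCat.{u} R))
    (Q : ChainComplex (ModuleCat.{u} R) ℕ) :
    ShortComplex (ChainComplex (ModuleCat.{u} R) ℕ) :=
  ShortComplex.mk (tensorComplexMap S.f Q) (tensorComplexMap S.g Q) <| by
    ext i : 1
    change S.f ▷ Q.X i ≫ S.g ▷ Q.X i = 0
    rw [← comp_whiskerRight, S.zero, MonoidalPreadditive.zero_whiskerRight]

theorem tensorShortComplex_shortExact {S : ShortComplex (ModuleCat.{u} R)} (hS : S.ShortExact)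
    (Q : ChainComplex (ModuleCat.{u} R) ℕ) [∀ i, Projective (Q.X i)] :
    (tensorShortComplex S Q).ShortExact := by
  refine HomologicalComplex.shortExact_of_degreewise_shortExact _ fun i => ?_
  have : Module.Projective R (Q.X i) := (IsProjective.iff_projective (Q.X i)).2 inferInstance
  exact hS.map_of_exact (tensorRight (Q.X i))

section ProjectiveResolution

variable {M : ModuleCat.{u} R} (Q : ProjectiveResolution M)

theorem isZero_homology_tensorComplex_of_flat (A : ModuleCat.{u} R) [Module.Flat R A] (j : ℕ) :
    Limits.IsZero ((tensorComplex A Q.complex).homology (j + 1)) := by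
  rw [← HomologicalComplex.exactAt_iff_isZero_homology,
    HomologicalComplex.exactAt_iff' _ (j + 2) (j + 1) j (by simp) (by simp),
    ShortComplex.ShortExact.moduleCat_exact_iff_function_exact]
  exact Module.Flat.lTensor_exact A
    ((ShortComplex.ShortExact.moduleCat_exact_iff_function_exact _).1 (Q.exact_succ j))

/-- The isomorphism `Tor j A M ≅ Hⱼ(A ⊗ Q)` for a projective resolution `Q` of `M`. -/
noncomputable def torIso (A : ModuleCat.{u} R) (j : ℕ) :
    ((Tor (ModuleCat.{u} R) j).obj A).obj M ≅ (tensorComplex A Q.complex).homology j :=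
  Q.isoLeftDerivedObj ((tensoringLeft (ModuleCat.{u} R)).obj A) j

instance (A : ModuleCat.{u} R) :
    Limits.PreservesFiniteColimits ((tensoringLeft (ModuleCat.{u} R)).obj A) :=
  inferInstanceAs (Limits.PreservesFiniteColimits (tensorLeft A))

/-- The isomorphism `H₀(A ⊗ Q) ≅ A ⊗ M` for a projective resolution `Q` of `M`. -/
noncomputable def homologyZeroIso (A : ModuleCat.{u} R) :
    (tensorComplex A Q.complex).homology 0 ≅ A ⊗ M :=
  ChainComplex.isoHomologyι₀ _ ≪≫
    asIso (Q.fromLeftDerivedZero' ((tensoringLeft (ModuleCat.{u} R)).obj A))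

theorem homologyZeroIso_naturality {A B : ModuleCat.{u} R} (f : A ⟶ B) :
    HomologicalComplex.homologyMap (tensorComplexMap f Q.complex) 0 ≫ (homologyZeroIso Q B).hom =
      (homologyZeroIso Q A).hom ≫ f ▷ M := by
  change HomologicalComplex.homologyMap (tensorComplexMap f Q.complex) 0 ≫
    HomologicalComplex.homologyι _ 0 ≫ _ = (HomologicalComplex.homologyι _ 0 ≫ _) ≫ _
  rw [HomologicalComplex.homologyι_naturality_assoc, Category.assoc]
  congr 1
  rw [← cancel_epi (HomologicalComplex.pOpcycles _ _), HomologicalComplex.p_opcyclesMap_assoc]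
  erw [ProjectiveResolution.pOpcycles_comp_fromLeftDerivedZero',
    ProjectiveResolution.pOpcycles_comp_fromLeftDerivedZero'_assoc]
  exact (whisker_exchange f (Q.π.f 0)).symm

end ProjectiveResolution

/-- `Tor₀(A, M) = A ⊗ M`. -/
noncomputable def torZeroEquiv (A M : ModuleCat.{u} R) :
    ((Tor (ModuleCat.{u} R) 0).obj A).obj M ≃ₗ[R] TensorProduct R A M :=
  (torIso (projectiveResolution M) A 0 ≪≫ homologyZeroIso _ A).toLinearEquiv

variable {A B C : Type u} [AddCommGroup A] [Module R A] [AddCommGroup B] [Module R B]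
  [AddCommGroup C] [Module R C] [Module.Flat R B] {f : A →ₗ[R] B} {g : B →ₗ[R] C}
  (hf : Function.Injective f) (hfg : Function.Exact f g) (hg : Function.Surjective g)
  (M : ModuleCat.{u} R)

/-- Dimension shifting for `Tor` in the first variable. -/
noncomputable def torSuccEquiv (j : ℕ) :
    ((Tor (ModuleCat.{u} R) (j + 2)).obj (ModuleCat.of R C)).obj M ≃ₗ[R]
      ((Tor (ModuleCat.{u} R) (j + 1)).obj (ModuleCat.of R A)).obj M :=
  let Q := projectiveResolution M
  have hS := tensorShortComplex_shortExact (shortExact_moduleCatMk hf hfg hg) Q.complex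
  have hj : (ComplexShape.down ℕ).Rel (j + 2) (j + 1) := by simp
  have : IsIso (hS.δ (j + 2) (j + 1) hj) :=
    hS.isIso_δ _ _ _ (isZero_homology_tensorComplex_of_flat Q (ModuleCat.of R B) _)
      (isZero_homology_tensorComplex_of_flat Q (ModuleCat.of R B) _)
  (torIso Q _ _ ≪≫ asIso (hS.δ (j + 2) (j + 1) hj) ≪≫ (torIso Q _ _).symm).toLinearEquiv

include hf hfg hg in
theorem nonempty_tor_one_equiv :
    Nonempty (((Tor (ModuleCat.{u} R) 1).obj (ModuleCat.of R C)).obj M ≃ₗ[R]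
      LinearMap.ker (f.rTensor M)) := by
  let Q := projectiveResolution M
  have hS := tensorShortComplex_shortExact (shortExact_moduleCatMk hf hfg hg) Q.complex
  let δ := hS.δ 1 0 (by simp)
  let e (X : ModuleCat.{u} R) := (homologyZeroIso Q X).toLinearEquiv
  have injective_δ : Function.Injective δ := by
    have : Mono δ :=
      hS.mono_δ _ _ _ (isZero_homology_tensorComplex_of_flat Q (ModuleCat.of R B) 0)
    exact (ModuleCat.mono_iff_injective δ).1 inferInstance
  let d := (e (ModuleCat.of R A)).toLinearMap ∘ₗ δ.hom
  have exact_d : Function.Exact d (f.rTensor M) :=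
    .of_ladder_linearEquiv_of_exact (e₁ := LinearEquiv.refl R _) (e₂ := e (ModuleCat.of R A))
      (e₃ := e (ModuleCat.of R B)) rfl
      (congrArg ModuleCat.Hom.hom (homologyZeroIso_naturality Q (ModuleCat.ofHom f))).symm
      ((ShortComplex.ShortExact.moduleCat_exact_iff_function_exact _).1
        (hS.homology_exact₁ 1 0 (by simp)))
  exact ⟨(torIso Q _ 1).toLinearEquiv ≪≫ₗ
    LinearEquiv.ofInjective d ((e _).injective.comp injective_δ) ≪≫ₗ
    LinearEquiv.ofEq _ _ exact_d.linearMap_ker_eq.symm⟩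

end Tor

/-! ### Transposes of syzygies -/

section DualCokernel

variable {R : Type u} [CommRing R]

/-- The cokernel of the dual map `φ^* : Q^* → P^*`. The transpose given by a presentation `P` is
`dualCoker P.d`. -/
abbrev dualCoker {P Q : Type u} [AddCommGroup P] [Module R P] [AddCommGroup Q] [Module R Q]
    (φ : P →ₗ[R] Q) : Type u :=
  Module.Dual R P ⧸ LinearMap.range φ.dualMap

variable {P Q P₂ L : Type u} [AddCommGroup P] [Module R P] [AddCommGroup Q] [Module R Q]
  [AddCommGroup P₂] [Module R P₂] [AddCommGroup L] [Module R L]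

section Exact

variable {δ : P₂ →ₗ[R] P} {π : P →ₗ[R] L}

/-- The map `dualCoker ι → dualCoker (ι ∘ π)` induced by `π^*`. -/
def dualCokerComp (ι : L →ₗ[R] Q) (π : P →ₗ[R] L) : dualCoker ι →ₗ[R] dualCoker (ι ∘ₗ π) :=
  Submodule.mapQ _ _ π.dualMap <| by
    rintro _ ⟨φ, rfl⟩
    exact ⟨φ, rfl⟩

/-- The map `dualCoker (ι ∘ π) → P₂^*` induced by `δ^*`, where `π ∘ δ = 0`. -/
def dualCokerLift (ι : L →ₗ[R] Q) (hδπ : Function.Exact δ π) :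
    dualCoker (ι ∘ₗ π) →ₗ[R] Module.Dual R P₂ :=
  Submodule.liftQ _ δ.dualMap <| by
    rintro _ ⟨φ, rfl⟩
    exact LinearMap.ext fun x => by simp [hδπ.apply_apply_eq_zero x]

variable (ι : L →ₗ[R] Q) (hπ : Function.Surjective π) (hδπ : Function.Exact δ π)

include hπ in
theorem injective_dualCokerComp : Function.Injective (dualCokerComp ι π) := by
  refine (injective_iff_map_eq_zero _).2 fun x hx => ?_
  obtain ⟨φ, rfl⟩ := Submodule.mkQ_surjective _ x
  obtain ⟨ψ, hψ⟩ := (Submodule.Quotient.mk_eq_zero _).1 hx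
  exact (Submodule.Quotient.mk_eq_zero _).2
    ⟨ψ, LinearMap.dualMap_injective_of_surjective hπ hψ⟩

include hπ in
theorem exact_dualCokerComp_dualCokerLift :
    Function.Exact (dualCokerComp ι π) (dualCokerLift ι hδπ) := by
  intro x
  obtain ⟨φ, rfl⟩ := Submodule.mkQ_surjective _ x
  have exact_dual := LinearMap.exact_lcomp_of_exact_of_surjective R hδπ hπ
  constructor
  · intro hφ
    obtain ⟨ψ, rfl⟩ := (exact_dual φ).1 hφ
    exact ⟨Submodule.Quotient.mk ψ, rfl⟩
  · rintro ⟨y, hy⟩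
    obtain ⟨ψ, rfl⟩ := Submodule.mkQ_surjective _ y
    exact hy ▸ exact_dual.apply_apply_eq_zero ψ

theorem exact_dualCokerLift_mkQ :
    Function.Exact (dualCokerLift ι hδπ) (LinearMap.range δ.dualMap).mkQ :=
  LinearMap.exact_iff.2 <| (Submodule.ker_mkQ _).trans (Submodule.range_liftQ _ _ _).symm

end Exact

variable (P) (M : Type u) [AddCommGroup M] [Module R M] [Module.Finite R P] [Module.Projective R P]

/-- The isomorphism `P ⊗ M ≃ Hom(P^*, M)` for a finitely generated projective module `P`. -/
noncomputable def tensorEquivHomDual :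
    TensorProduct R P M ≃ₗ[R] (Module.Dual R P →ₗ[R] M) :=
  TensorProduct.congr (Module.evalEquiv R P) (LinearEquiv.refl R M) ≪≫ₗ
    dualTensorHomEquiv R (Module.Dual R P) M

variable {P}

theorem tensorEquivHomDual_comp_rTensor [Module.Finite R Q] [Module.Projective R Q]
    (φ : P →ₗ[R] Q) :
    (tensorEquivHomDual Q M).toLinearMap ∘ₗ φ.rTensor M =
      LinearMap.lcomp R M φ.dualMap ∘ₗ (tensorEquivHomDual P M).toLinearMap :=
  TensorProduct.ext' fun x m => LinearMap.ext fun f => by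
    simp [tensorEquivHomDual]

/-- The map `Hom(Coker φ^*, M) → Hom(P^*, M) = P ⊗ M`. -/
noncomputable def homDualCokerToTensor (φ : P →ₗ[R] Q) :
    (dualCoker φ →ₗ[R] M) →ₗ[R] TensorProduct R P M :=
  (tensorEquivHomDual P M).symm.toLinearMap ∘ₗ
    LinearMap.lcomp R M (LinearMap.range φ.dualMap).mkQ

theorem injective_homDualCokerToTensor (φ : P →ₗ[R] Q) :
    Function.Injective (homDualCokerToTensor M φ) :=
  (tensorEquivHomDual P M).symm.injective.comp
    (LinearMap.lcomp_injective_of_surjective _ (Submodule.mkQ_surjective _))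

theorem exact_homDualCokerToTensor [Module.Finite R Q] [Module.Projective R Q] (φ : P →ₗ[R] Q) :
    Function.Exact (homDualCokerToTensor M φ) (φ.rTensor M) := by
  refine .of_ladder_linearEquiv_of_exact (e₁ := LinearEquiv.refl R _)
    (e₂ := (tensorEquivHomDual P M).symm) (e₃ := (tensorEquivHomDual Q M).symm) rfl ?_
    (LinearMap.exact_lcomp_of_exact_of_surjective M
      (LinearMap.exact_map_mkQ_range φ.dualMap) (Submodule.mkQ_surjective _))
  rw [LinearEquiv.eq_toLinearMap_symm_comp, ← LinearMap.comp_assoc,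
    tensorEquivHomDual_comp_rTensor, LinearMap.comp_assoc]
  simp

variable {δ : P₂ →ₗ[R] P} {π : P →ₗ[R] L} (ι : L →ₗ[R] Q)
  (hπ : Function.Surjective π) (hδπ : Function.Exact δ π)

theorem homDualCokerToTensor_comp_lcomp_dualCokerLift
    [Module.Finite R P₂] [Module.Projective R P₂] :
    homDualCokerToTensor M (ι ∘ₗ π) ∘ₗ LinearMap.lcomp R M (dualCokerLift ι hδπ) ∘ₗ
      (tensorEquivHomDual P₂ M).toLinearMap = δ.rTensor M := by
  rw [homDualCokerToTensor, LinearMap.comp_assoc, LinearEquiv.toLinearMap_symm_comp_eq,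
    tensorEquivHomDual_comp_rTensor]
  rfl

include hπ in
theorem exact_rTensor_comp_homDualCokerToTensor [Module.Finite R Q] [Module.Projective R Q] :
    Function.Exact (π.rTensor M ∘ₗ homDualCokerToTensor M (ι ∘ₗ π)) (ι.rTensor M) := by
  intro y
  obtain ⟨z, rfl⟩ := LinearMap.rTensor_surjective M hπ y
  have exact_z := exact_homDualCokerToTensor M (ι ∘ₗ π)
  rw [LinearMap.rTensor_comp] at exact_z
  constructor
  · intro hz
    obtain ⟨w, rfl⟩ := (exact_z z).1 hz
    exact ⟨w, rfl⟩
  · rintro ⟨w, hw⟩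
    exact hw ▸ exact_z.apply_apply_eq_zero w

include hπ in
theorem exact_lcomp_dualCokerLift [Module.Finite R P₂] [Module.Projective R P₂] :
    Function.Exact (LinearMap.lcomp R M (dualCokerLift ι hδπ))
      (π.rTensor M ∘ₗ homDualCokerToTensor M (ι ∘ₗ π)) := by
  have comp_eq (y) := LinearMap.congr_fun
    (homDualCokerToTensor_comp_lcomp_dualCokerLift M ι hδπ) y
  intro w
  refine (rTensor_exact M hδπ hπ (homDualCokerToTensor M (ι ∘ₗ π) w)).trans ⟨?_, ?_⟩
  · rintro ⟨y, hy⟩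
    exact ⟨tensorEquivHomDual P₂ M y,
      injective_homDualCokerToTensor M (ι ∘ₗ π) ((comp_eq y).trans hy)⟩
  · rintro ⟨v, rfl⟩
    obtain ⟨y, rfl⟩ := (tensorEquivHomDual P₂ M).surjective v
    exact ⟨y, (comp_eq y).symm⟩

variable [Module.Finite R Q] [Module.Projective R Q] [Module.Finite R P₂] [Module.Projective R P₂]

/-- The cokernel of `Hom(P₂^*, M) → Hom(Coker (ι ∘ π)^*, M)` is the kernel of
`L ⊗ M → Q ⊗ M`. -/
noncomputable def extCokerDualCokerLiftEquivKer :
    extCoker (ModuleCat.ofHom (dualCokerLift ι hδπ)) (ModuleCat.of R M) 0 ≃ₗ[R]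
      LinearMap.ker (ι.rTensor M) :=
  extCokerZeroEquiv (ModuleCat.ofHom (dualCokerLift ι hδπ)) (ModuleCat.of R M) ≪≫ₗ
    Submodule.quotEquivOfEq _ _ (exact_lcomp_dualCokerLift M ι hπ hδπ).linearMap_ker_eq.symm ≪≫ₗ
    LinearMap.quotKerEquivRange _ ≪≫ₗ
    LinearEquiv.ofEq _ _ (exact_rTensor_comp_homDualCokerToTensor M ι hπ).linearMap_ker_eq.symm

end DualCokernel

section Syzygy

variable {R : Type u} [CommRing R]

theorem IsSyzygy.exists_exact {n : ℕ} {K S : ModuleCat.{u} R} (hS : IsSyzygy (n + 1) K S) :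
    ∃ L : ModuleCat.{u} R, IsSyzygy n K L ∧ ∃ (Q : ModuleCat.{u} R)
      (_ : Module.Finite R Q) (_ : Module.Projective R Q) (ι : S →ₗ[R] Q) (π : Q →ₗ[R] L),
      Function.Injective ι ∧ Function.Exact ι π ∧ Function.Surjective π := by
  obtain ⟨L, hL, P, ⟨e⟩⟩ := hS
  refine ⟨L, hL, P.P₀, P.finite₀, P.projective₀,
    (LinearMap.range P.d).subtype ∘ₗ e.toLinearMap, P.ε,
    (Submodule.subtype_injective _).comp e.injective, LinearMap.exact_iff.2 ?_, P.surjective⟩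
  rw [P.exact.linearMap_ker_eq, LinearEquiv.range_comp, Submodule.range_subtype]

theorem IsSyzygy.nonempty_ext_equiv {n : ℕ} {K S : ModuleCat.{u} R} (hS : IsSyzygy n K S)
    (M : ModuleCat.{u} R) (i : ℕ) :
    Nonempty (Ext S M (i + 1) ≃ₗ[R] Ext K M (n + i + 1)) := by
  induction n generalizing S i with
  | zero =>
    obtain ⟨e⟩ := hS
    rw [zero_add]
    exact ⟨extCongrLeft e M _⟩
  | succ n ih =>
    obtain ⟨L, hL, Q, _, _, ι, π, hι, hιπ, hπ⟩ := hS.exists_exact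
    have : Projective (ModuleCat.of R Q) := (IsProjective.iff_projective Q).1 inferInstance
    obtain ⟨e⟩ := ih hL (i + 1)
    rw [show n + 1 + i + 1 = n + (i + 1) + 1 by omega]
    exact ⟨(extCokerSuccEquiv (ModuleCat.ofHom ι) M i).symm ≪≫ₗ
      extCokerEquivExtSucc M hι hιπ hπ (i + 1) ≪≫ₗ e⟩

theorem IsSyzygy.nonempty_tor_equiv {n : ℕ} {K S : ModuleCat.{u} R} (hS : IsSyzygy n K S)
    (M : ModuleCat.{u} R) (i : ℕ) :
    Nonempty (((Tor (ModuleCat.{u} R) (i + 1)).obj S).obj M ≃ₗ[R]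
      ((Tor (ModuleCat.{u} R) (n + i + 1)).obj K).obj M) := by
  induction n generalizing S i with
  | zero =>
    obtain ⟨e⟩ := hS
    rw [zero_add]
    exact ⟨(((Tor (ModuleCat.{u} R) (i + 1)).mapIso e.toModuleIso).app M).toLinearEquiv⟩
  | succ n ih =>
    obtain ⟨L, hL, Q, _, _, ι, π, hι, hιπ, hπ⟩ := hS.exists_exact
    obtain ⟨e⟩ := ih hL (i + 1)
    rw [show n + 1 + i + 1 = n + (i + 1) + 1 by omega]
    exact ⟨(torSuccEquiv hι hιπ hπ M i).symm ≪≫ₗ e⟩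

variable {S Q L : Type u} [AddCommGroup S] [Module R S] [AddCommGroup Q] [Module R Q]
  [AddCommGroup L] [Module R L] [Module.Projective R Q] {ι : S →ₗ[R] Q} {π : Q →ₗ[R] L}

/-- `Coker ι^* = Ext¹(L, R)` for an exact sequence `0 → S → Q → L → 0` with `Q` projective. -/
noncomputable def dualCokerEquivExtOne (hι : Function.Injective ι) (hιπ : Function.Exact ι π)
    (hπ : Function.Surjective π) :
    dualCoker ι ≃ₗ[R] Ext (ModuleCat.of R L) (ModuleCat.of R R) 1 :=
  (extCokerZeroEquiv (ModuleCat.ofHom ι) (ModuleCat.of R R)).symm ≪≫ₗ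
    extCokerEquivExtSucc (ModuleCat.of R R) hι hιπ hπ 0

/-- The presentation of `L` obtained by splicing a presentation of `S` with an exact sequence
`S → Q → L → 0`. -/
def ProjPres.splice [Module.Finite R Q] (P : ProjPres R S) (hιπ : Function.Exact ι π)
    (hπ : Function.Surjective π) : ProjPres R L where
  P₁ := P.P₀
  P₀ := ModuleCat.of R Q
  finite₁ := P.finite₀
  finite₀ := inferInstanceAs (Module.Finite R Q)
  projective₁ := P.projective₀
  projective₀ := inferInstanceAs (Module.Projective R Q)
  d := ι ∘ₗ P.ε
  ε := π
  exact := P.surjective.comp_exact_iff_exact.2 hιπ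
  surjective := hπ

end Syzygy

section ReversedTor

variable {R : Type u} [CommRing R]

/-- The module `Tor_{n - i}(K, M)` for `i ≤ n`, and zero for `i > n`: the middle column
of the long exact sequence for `Ext(Tr Ωⁿ K, M)`. -/
noncomputable def reversedTor (K M : ModuleCat.{u} R) (n i : ℕ) : ModuleCat.{u} R :=
  if i ≤ n then ((Tor (ModuleCat.{u} R) (n - i)).obj K).obj M else ModuleCat.of R PUnit

variable (K M : ModuleCat.{u} R)

theorem reversedTor_of_le {n i : ℕ} (h : i ≤ n) :
    reversedTor K M n i = ((Tor (ModuleCat.{u} R) (n - i)).obj K).obj M := if_pos h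

theorem reversedTor_succ_succ (n i : ℕ) :
    reversedTor K M (n + 1) (i + 1) = reversedTor K M n i := by
  simp only [reversedTor, Nat.add_le_add_iff_right, Nat.add_sub_add_right]

theorem subsingleton_reversedTor {n i : ℕ} (h : n < i) : Subsingleton (reversedTor K M n i) := by
  rw [reversedTor, if_neg h.not_ge]
  infer_instance

theorem finite_reversedTor_self (K M : ModuleCat.{u} R) [Module.Finite R K] [Module.Finite R M]
    (n : ℕ) : Module.Finite R (reversedTor K M n n) := by
  rw [reversedTor_of_le K M le_rfl, Nat.sub_self]
  exact Module.Finite.equiv (torZeroEquiv K M).symm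

end ReversedTor

section TransposeOfSyzygy

variable {R : Type u} [CommRing R]

theorem ProjPres.nonempty_longExactSequence {S Q : Type u} [AddCommGroup S] [Module R S]
    [AddCommGroup Q] [Module R Q] [Module.Finite R Q] [Module.Projective R Q] (P : ProjPres R S)
    (ι : S →ₗ[R] Q) (M : ModuleCat.{u} R) {B : ℕ → ModuleCat.{u} R}
    (e_zero : LinearMap.ker (ι.rTensor M) ≃ₗ[R] B 0)
    (e_succ : ∀ i, Ext (ModuleCat.of R (dualCoker (ι ∘ₗ P.ε))) M (i + 1) ≃ₗ[R] B (i + 1)) :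
    Nonempty (LongExactSequence R (fun i => Ext (ModuleCat.of R P.transpose) M (i + 1)) (B ·)
      (Ext (ModuleCat.of R (dualCoker ι)) M ·)) := by
  have := P.finite₀
  have := P.finite₁
  have := P.projective₀
  have := P.projective₁
  obtain ⟨s⟩ := nonempty_longExactSequence_extCoker M (injective_dualCokerComp ι P.surjective)
    (exact_dualCokerComp_dualCokerLift ι P.surjective P.exact) (exact_dualCokerLift_mkQ ι P.exact)
    (Submodule.mkQ_surjective _)
  have : Projective (ModuleCat.of R (Module.Dual R P.P₁)) :=
    (IsProjective.iff_projective _).1 inferInstance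
  refine ⟨s.congr (fun _ => LinearEquiv.refl R _) (fun i => ?_) fun _ => LinearEquiv.refl R _⟩
  exact match i with
  | 0 => extCokerDualCokerLiftEquivKer M ι P.surjective P.exact ≪≫ₗ e_zero
  | i + 1 => extCokerSuccEquiv _ M i ≪≫ₗ e_succ i

/-- If the target of `φ` is zero, then the dual map contributes nothing to the cokernel. -/
def dualCokerEquivDual {P Q : Type u} [AddCommGroup P] [Module R P] [AddCommGroup Q]
    [Module R Q] [Subsingleton Q] (φ : P →ₗ[R] Q) : dualCoker φ ≃ₗ[R] Module.Dual R P :=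
  Submodule.quotEquivOfEqBot _ <| by
    rw [Subsingleton.elim φ.dualMap 0, LinearMap.range_zero]

theorem IsTranspose.finite {S T : ModuleCat.{u} R} (hT : IsTranspose S T) :
    Module.Finite R T := by
  obtain ⟨P, ⟨e⟩⟩ := hT
  have := P.finite₁
  have := P.projective₁
  exact Module.Finite.equiv e.symm

theorem IsTranspose.of_equiv {S K T : ModuleCat.{u} R} (hT : IsTranspose S T) (e : S ≃ₗ[R] K) :
    IsTranspose K T := by
  obtain ⟨P, eT⟩ := hT
  exact ⟨{ P with
    ε := e.toLinearMap ∘ₗ P.ε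
    exact := e.postcomp_exact_iff_exact.2 P.exact
    surjective := e.surjective.comp P.surjective }, eT⟩

theorem IsTranspose.nonempty_longExactSequence {S T : ModuleCat.{u} R} (hT : IsTranspose S T)
    (M : ModuleCat.{u} R) :
    Nonempty (LongExactSequence R (fun i => Ext T M (i + 1)) (reversedTor S M 0 ·)
      (Ext (ModuleCat.of R (Module.Dual R S)) M ·)) := by
  obtain ⟨P, ⟨eT⟩⟩ := hT
  have := P.finite₀
  have := P.projective₀
  let ι : S →ₗ[R] PUnit.{u + 1} := 0
  have e_zero : LinearMap.ker (ι.rTensor M) ≃ₗ[R] reversedTor S M 0 0 :=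
    LinearEquiv.ofTop _ (by simp only [ι, LinearMap.rTensor_zero, LinearMap.ker_zero]) ≪≫ₗ
      (torZeroEquiv S M).symm ≪≫ₗ
      (eqToIso (reversedTor_of_le S M (Nat.zero_le 0)).symm).toLinearEquiv
  have e_succ (i : ℕ) : Ext (ModuleCat.of R (dualCoker (ι ∘ₗ P.ε))) M (i + 1) ≃ₗ[R]
      reversedTor S M 0 (i + 1) := by
    have : Projective (ModuleCat.of R (Module.Dual R P.P₀)) :=
      (IsProjective.iff_projective _).1 inferInstance
    have := Ext.subsingleton_of_projective (ModuleCat.of R (Module.Dual R P.P₀)) M i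
    have := subsingleton_reversedTor S M i.succ_pos
    exact extCongrLeft (B := ModuleCat.of R (Module.Dual R P.P₀)) (dualCokerEquivDual _) M (i + 1)
      ≪≫ₗ 0
  obtain ⟨s⟩ := P.nonempty_longExactSequence ι M e_zero e_succ
  exact ⟨s.congr (fun i => extCongrLeft eT.symm M (i + 1)) (fun _ => LinearEquiv.refl R _)
    fun i => extCongrLeft (dualCokerEquivDual ι) M i⟩

theorem IsSyzygy.nonempty_longExactSequence {n : ℕ} {K S T : ModuleCat.{u} R}
    (hS : IsSyzygy n K S) (hT : IsTranspose S T)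
    (hK : ∀ i < n, Subsingleton (Ext K (ModuleCat.of R R) i)) (M : ModuleCat.{u} R) :
    Nonempty (LongExactSequence R (fun i => Ext T M (i + 1)) (reversedTor K M n ·)
      (Ext (ModuleCat.of R (Ext K (ModuleCat.of R R) n)) M ·)) := by
  induction n generalizing S T with
  | zero =>
    obtain ⟨e⟩ := hS
    obtain ⟨s⟩ := (hT.of_equiv e).nonempty_longExactSequence M
    exact ⟨s.congr (fun _ => LinearEquiv.refl R _) (fun _ => LinearEquiv.refl R _)
      fun i => extCongrLeft (extZeroEquiv K (ModuleCat.of R R)).symm M i⟩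
  | succ n ih =>
    obtain ⟨P, ⟨eT⟩⟩ := hT
    obtain ⟨L, hL, Q, _, _, ι, π, hι, hιπ, hπ⟩ := hS.exists_exact
    obtain ⟨eX⟩ := hL.nonempty_ext_equiv (ModuleCat.of R R) 0
    obtain ⟨eTorOne⟩ := nonempty_tor_one_equiv hι hιπ hπ M
    obtain ⟨eTor⟩ := hL.nonempty_tor_equiv M 0
    have := hK n n.lt_succ_self
    obtain ⟨s'⟩ := ih (T := ModuleCat.of R (dualCoker (ι ∘ₗ P.ε))) hL
      ⟨P.splice hιπ hπ, ⟨LinearEquiv.refl R _⟩⟩ fun i hi => hK i (hi.trans n.lt_succ_self)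
    have e_zero : LinearMap.ker (ι.rTensor M) ≃ₗ[R] reversedTor K M (n + 1) 0 :=
      eTorOne.symm ≪≫ₗ eTor ≪≫ₗ
        (eqToIso (reversedTor_of_le K M (n + 1).zero_le).symm).toLinearEquiv
    have e_succ (i : ℕ) : Ext (ModuleCat.of R (dualCoker (ι ∘ₗ P.ε))) M (i + 1) ≃ₗ[R]
        reversedTor K M (n + 1) (i + 1) :=
      LinearEquiv.ofBijective (s'.a i)
          (s'.bijective_a fun m _ => subsingleton_ext_of_subsingleton_left M m) ≪≫ₗ
        (eqToIso (reversedTor_succ_succ K M n i).symm).toLinearEquiv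
    obtain ⟨s⟩ := P.nonempty_longExactSequence ι M e_zero e_succ
    exact ⟨s.congr (fun i => extCongrLeft eT.symm M (i + 1)) (fun _ => LinearEquiv.refl R _)
      fun i => extCongrLeft (dualCokerEquivExtOne hι hιπ hπ ≪≫ₗ eX) M i⟩

end TransposeOfSyzygy

/-! ### The residue field -/

section Dimension

variable {R : Type u} [CommRing R] [IsLocalRing R]

theorem IsResidueSpace.nonempty_ext_equiv_pi {X : ModuleCat.{u} R} [Module.Finite R X]
    (hX : IsResidueSpace R X) (M : ModuleCat.{u} R) (n : ℕ) :
    Nonempty (Ext X M n ≃ₗ[R] (Fin hX.dim → Ext (resField R) M n)) := by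
  obtain ⟨e⟩ := hX.nonempty_equiv_pi
  exact ⟨extCongrLeft (B := ModuleCat.of R (Fin hX.dim → ResidueField R)) e M n ≪≫ₗ
    extPiEquiv (Fin hX.dim) (resField R) M n⟩

theorem IsResidueSpace.isResidueSpace_ext {X : ModuleCat.{u} R} [Module.Finite R X]
    (hX : IsResidueSpace R X) (M : ModuleCat.{u} R) (n : ℕ) : IsResidueSpace R (Ext X M n) := by
  obtain ⟨e⟩ := hX.nonempty_ext_equiv_pi M n
  exact ((ext_resField_isResidueSpace M n).pi _).of_injective e.toLinearMap e.injective

theorem IsResidueSpace.dim_ext [IsNoetherianRing R] {X : ModuleCat.{u} R} [Module.Finite R X]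
    (hX : IsResidueSpace R X) (M : ModuleCat.{u} R) [Module.Finite R M] (n : ℕ) :
    (hX.isResidueSpace_ext M n).dim = hX.dim * bass n M := by
  obtain ⟨e⟩ := hX.nonempty_ext_equiv_pi M n
  exact (dim_congr _ _ e).trans ((ext_resField_isResidueSpace M n).dim_pi _)

theorem IsResidueSpace.subsingleton_ext_of_lt_depth [IsNoetherianRing R] {X M : ModuleCat.{u} R}
    [Module.Finite R X] (hX : IsResidueSpace R X) [Module.Finite R M] {n : ℕ}
    (h : (n : ℕ∞) < depth R M) : Subsingleton (Ext X M n) := by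
  obtain ⟨e⟩ := hX.nonempty_ext_equiv_pi M n
  have := subsingleton_ext_resField_of_lt_depth h
  exact e.toEquiv.subsingleton

theorem reversedTor_resField_isResidueSpace (M : ModuleCat.{u} R) (n i : ℕ) :
    IsResidueSpace R (reversedTor (resField R) M n i) := by
  rcases le_or_gt i n with h | h
  · rw [reversedTor_of_le _ M h]
    exact tor_resField_isResidueSpace M (n - i)
  · have := subsingleton_reversedTor (resField R) M h
    exact .of_subsingleton

theorem dim_reversedTor_resField (M : ModuleCat.{u} R) {n i : ℕ} (h : i ≤ n) :
    (reversedTor_resField_isResidueSpace M n i).dim = betti (n - i) M :=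
  IsResidueSpace.dim_congr _ _ (eqToIso (reversedTor_of_le _ M h)).toLinearEquiv

end Dimension

end LocalExt

open LocalExt in
theorem theorem3p4_general (R : Type u) [CommRing R] [IsNoetherianRing R] [IsLocalRing R]
    (t : ℕ) (ht : (t : ℕ∞) ≤ depth R R)
    (M : ModuleCat.{u} R) [Module.Finite R M] (hM : (t : ℕ∞) ≤ depth R M)
    (S T : ModuleCat.{u} R) (hS : IsSyzygy t (resField R) S) (hT : IsTranspose S T) :
    ∃ h : ∀ i : ℕ, 0 < i → IsResidueSpace R (Ext T M i),
      (∀ i : ℕ, 0 < i → Module.Finite R (Ext T M i)) ∧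
      (∀ (i : ℕ) (hi : 1 ≤ i), i ≤ t → (h i hi).dim = betti (t - i + 1) M) ∧
      ((h (t + 1) t.succ_pos).dim : ℤ) - ((h (t + 2) (t + 1).succ_pos).dim : ℤ) =
        (betti 0 M : ℤ) - (bass t (ModuleCat.of R R) : ℤ) * (bass t M : ℤ) ∧
      (∀ (i : ℕ) (hi : t + 3 ≤ i),
        (h i (Nat.zero_lt_of_lt hi)).dim = bass t (ModuleCat.of R R) * bass (i - 2) M) := by
  have := hT.finite
  have hX := ext_resField_isResidueSpace (ModuleCat.of R R) t
  let X := ModuleCat.of R (Ext (resField R) (ModuleCat.of R R) t)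
  have hR (i : ℕ) (hi : i < t) : Subsingleton (Ext (resField R) (ModuleCat.of R R) i) :=
    subsingleton_ext_resField_of_lt_depth ((Nat.cast_lt.2 hi).trans_le ht)
  obtain ⟨s⟩ := hS.nonempty_longExactSequence hT hR M
  have hB (n : ℕ) (hn : t < n) := subsingleton_reversedTor (resField R) M hn
  have hC (n : ℕ) (hn : n < t) : Subsingleton (Ext X M n) :=
    hX.subsingleton_ext_of_lt_depth ((Nat.cast_lt.2 hn).trans_le hM)
  have resB := reversedTor_resField_isResidueSpace M t
  have resC (n : ℕ) : IsResidueSpace R (Ext X M n) := hX.isResidueSpace_ext M n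
  have resA := s.isResidueSpace hB hC resB resC
  have := finite_reversedTor_self (resField R) M t
  refine ⟨fun | i + 1, _ => resA i, fun i _ => inferInstance, ?_, ?_, ?_⟩
  · rintro (_ | i) hi hit
    · contradiction
    · rw [s.dim_eq_of_lt hC resA resB hit, dim_reversedTor_resField M (Nat.le_of_succ_le hit)]
      congr 1
      omega
  · rw [s.dim_sub_dim hB hC resA resB resC, dim_reversedTor_resField M le_rfl, hX.dim_ext M t]
    simp [bass]
  · rintro (_ | _ | i) hi
    · omega
    · omega
    · exact (s.dim_eq_of_gt hB resA resC (by omega)).trans (hX.dim_ext M i)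

theorem theorem3p4 (R : Type u) [CommRing R] [IsNoetherianRing R] [IsLocalRing R]
    (t : ℕ) (ht : LocalExt.depth R R = t)
    (M : ModuleCat.{u} R) [Module.Finite R M] (hM : (t : ℕ∞) ≤ LocalExt.depth R M)
    -- `T` is any module of the form `Tr Ω^t k`
    (S T : ModuleCat.{u} R) (hS : LocalExt.IsSyzygy t (LocalExt.resField R) S)
    (hT : LocalExt.IsTranspose S T) :
    ∃ h : ∀ i : ℕ, 0 < i → LocalExt.IsResidueSpace R (Ext T M i),
      (∀ i : ℕ, 0 < i → Module.Finite R (Ext T M i)) ∧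
      (∀ (i : ℕ) (hi : 1 ≤ i), i ≤ t → (h i hi).dim = LocalExt.betti (t - i + 1) M) ∧
      ((h (t + 1) (by omega)).dim : ℤ) - ((h (t + 2) (by omega)).dim : ℤ) =
        (LocalExt.betti 0 M : ℤ) - (LocalExt.ringType R : ℤ) * (LocalExt.bass t M : ℤ) ∧
      (∀ (i : ℕ) (hi : t + 3 ≤ i),
        (h i (by omega)).dim = LocalExt.ringType R * LocalExt.bass (i - 2) M) := by
  rw [show LocalExt.ringType R = LocalExt.bass t (ModuleCat.of R R) by simp [LocalExt.ringType, ht]]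
  exact theorem3p4_general R t ht.ge M hM S T hS hT
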